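/- **Conventions.** All foliations on manifolds with boundary are, on each boundary component, either tangent or transverse to it. Distances take values in $[0,\infty]$ (the distance of points in different components of a manifold is $\infty$; all distances are finite for connected manifolds). For a compact Riemannian manifold $(M,g)$ with a foliation $\mathcal F$, let $$\rho(L,L')=\inf\sum_{i=1}^{k-1}\operatorname{dist}(L_i,L_{i+1}),$$ the infimum being over all finite sequences of leaves with $L_1=L$, $L_k=L'$. The Hausdorff leaf space $HLS(\mathcal F)$ is the metric space obtained from the space of leaves with $\rho$ by identifying leaves with $\rho(L,L')=0$; $\pi:M\to HLS(\mathcal F)$ denotes the projection sending $x$ to the class of the leaf through $x$. If $(Z,d)$ is a metric space and $\sim$ an equivalence relation on $Z$, the quotient metric space is obtained from $Z/{\sim}$ with the pseudo-metric $$d_\sim(a,b)=\inf\Big\{\sum_{i=0}^{k}d(p_i,q_i)\;:\;p_0\in a,\ q_k\in b,\ q_i\sim p_{i+1}\ (0\le i<k)\Big\}$$ by identifying points at distance $0$. **Theorem.** Let $(M_1,\mathcal F_1,g_1)$ and $(M_2,\mathcal F_2,g_2)$ be smooth compact foliated Riemannian manifolds with boundary, of dimension $n\ge 1$ and codimension $q$.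 Let $S_i\subset\partial M_i$ be a union of boundary components, such that $\mathcal F_i$ is $g_i$-orthogonal to $S_i$ (that is, at each point of $S_i$ the vectors normal to $\partial M_i$ are tangent to $\mathcal F_i$). Let $\varphi:S_1\to S_2$ be an isometry (for the induced Riemannian distances of $S_1$ and $S_2$) mapping the leaves of $\mathcal F_1|_{S_1}$ onto leaves of $\mathcal F_2|_{S_2}$. Let $M=M_1\cup_\varphi M_2$ be the quotient of $M_1\sqcup M_2$ by $x\sim\varphi(x)$, $x\in S_1$, with quotient projection $p:M_1\sqcup M_2\to M$. Equip $M$ with a smooth structure for which the inclusions of $M_1$ and $M_2$ are smooth and with a (continuous or smooth) Riemannian metric $g$ with $g|_{M_i}=g_i$, and let $\mathcal F$ be the induced foliation of $M$, i.e. the foliation (of any regularity, possibly only $C^0$) that restricts to $\mathcal F_i$ on $M_i$, $i=1,2$. Let $\tilde\pi:M_1\sqcup M_2\to HLS(\mathcal F_1)\sqcup HLS(\mathcal F_2)$ be the disjoint union of the projections $\pi_1,\pi_2$; give the target the metric extending those of the two pieces in which points of different pieces have distance $\infty$. Let $(X,d_X)$ be its quotient metric space by the smallest equivalence relation containing $\tilde\pi(x)\sim\tilde\pi(\varphi(x))$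 for all $x\in S_1$, and let $\Phi$ be the natural projection of $HLS(\mathcal F_1)\sqcup HLS(\mathcal F_2)$ onto $X$. Then $HLS(\mathcal F)$ coincides with $(X,d_X)$: there is a bijective isometry $\Psi:HLS(\mathcal F)\to X$ such that $\Psi(\pi(p(z)))=\Phi(\tilde\pi(z))$ for all $z\in M_1\sqcup M_2$. -/

import Mathlib

open Set Manifold Bundle
open scoped ContDiff ENNReal

noncomputable section

/-! ## Foliations -/

/-- A foliation of codimension `q` and class `C^r` on an `n`-manifold `M` with (possibly empty)
boundary, given by a foliated atlas.  A foliated chart is a chart `e` of `M` with values in the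
half-space `{x | 0 ≤ x 0}` of `ℝⁿ` together with the set `J` of its `q` transverse coordinates; its
slices are the sets on which all the coordinates `x j`, `j ∈ J`, are constant.  If `0 ∉ J` the
slices are transverse to the boundary, if `0 ∈ J` the boundary is a union of slices.  Hence the
foliation is transverse or tangent to each boundary component.  Two foliated charts must have
locally the same slices. -/
structure Foliation (n : ℕ) [NeZero n] (q : ℕ) (r : ℕ∞ω) (M : Type*) [TopologicalSpace M]
    [ChartedSpace (EuclideanHalfSpace n) M] where
  /-- the foliated charts, each with its set of transverse coordinates -/
  atlas : Set (OpenPartialHomeomorph M (EuclideanHalfSpace n) × Finset (Fin n))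
  chart_mem : ∀ e ∈ atlas, e.1 ∈ IsManifold.maximalAtlas (𝓡∂ n) r M
  card_transverse : ∀ e ∈ atlas, e.2.card = q
  exists_chart : ∀ x : M, ∃ e ∈ atlas, x ∈ e.1.source
  compatible : ∀ e ∈ atlas, ∀ e' ∈ atlas, ∀ x ∈ e.1.source ∩ e'.1.source,
    ∃ U : Set M, IsOpen U ∧ x ∈ U ∧ U ⊆ e.1.source ∩ e'.1.source ∧
      ∀ y ∈ U, ∀ z ∈ U,
        (∀ j ∈ e.2, (e.1 y).val j = (e.1 z).val j) → ∀ j ∈ e'.2, (e'.1 y).val j = (e'.1 z).val j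

/-- The slice through `x` of the chart `e` with transverse coordinates `J`. -/
def chartSlice {n : ℕ} [NeZero n] {M : Type*} [TopologicalSpace M]
    (e : OpenPartialHomeomorph M (EuclideanHalfSpace n) × Finset (Fin n)) (x : M) : Set M :=
  {y | y ∈ e.1.source ∧ ∀ j ∈ e.2, (e.1 y).val j = (e.1 x).val j}

namespace Foliation

variable {n : ℕ} [NeZero n] {q : ℕ} {r : ℕ∞ω} {M : Type*} [TopologicalSpace M]
  [ChartedSpace (EuclideanHalfSpace n) M]

/-- The leaf topology: a set is open if and only if it meets every slice of every foliated chart in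
a relatively open subset of that slice. -/
@[reducible] def leafTopology (F : Foliation n q r M) : TopologicalSpace M where
  IsOpen U := ∀ e ∈ F.atlas, ∀ x ∈ e.1.source,
    IsOpen ((fun y : chartSlice e x => (y : M)) ⁻¹' U)
  isOpen_univ := by
    intro e _ x _
    exact isOpen_univ
  isOpen_inter := by
    intro U V hU hV e he x hx
    exact (hU e he x hx).inter (hV e he x hx)
  isOpen_sUnion := by
    intro C hC e he x hx
    rw [preimage_sUnion]
    exact isOpen_biUnion fun U hU => hC U hU e he x hx

/-- The leaf through `x`: its connected component in the leaf topology. -/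
def leaf (F : Foliation n q r M) (x : M) : Set M :=
  @connectedComponent M F.leafTopology x

/-- The leaf through `x` of the restriction of the foliation to a subset `S` (in practice a union of
boundary components transverse to the foliation): the connected component of `x` in `S` with
respect to the leaf topology. -/
def leafIn (F : Foliation n q r M) (S : Set M) (x : M) : Set M :=
  @connectedComponentIn M F.leafTopology S x

/-- The tangent space at `x` of a foliation (of class at least `C^1`): the vectors killed by the
differentials of all transverse coordinates. -/
def tangentSpace (F : Foliation n q r M) (x : M) : Set (TangentSpace (𝓡∂ n) x) :=
  {v | ∀ e ∈ F.atlas, x ∈ e.1.source → ∀ j ∈ e.2,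
    (show EuclideanSpace ℝ (Fin n) from
      mfderiv (𝓡∂ n) 𝓘(ℝ, EuclideanSpace ℝ (Fin n)) (e.1.extend (𝓡∂ n)) x v) j = 0}

/-- The space of leaves. -/
def LeafSpace (F : Foliation n q r M) : Type _ := range F.leaf

/-- The leaf through `x` as a point of the space of leaves. -/
def toLeafSpace (F : Foliation n q r M) (x : M) : F.LeafSpace := ⟨F.leaf x, mem_range_self x⟩

/-- `F'` restricts to `F` along `f : M → M'` (in practice the inclusion of a submanifold with
boundary of codimension zero): locally the slices of `F` are the preimages of the slices
of `F'`. -/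
def RestrictsTo {r' : ℕ∞ω} {M' : Type*} [TopologicalSpace M']
    [ChartedSpace (EuclideanHalfSpace n) M']
    (F' : Foliation n q r' M') (F : Foliation n q r M) (f : M → M') : Prop :=
  ∀ x : M, ∀ e ∈ F.atlas, x ∈ e.1.source → ∀ e' ∈ F'.atlas, f x ∈ e'.1.source →
    ∃ U : Set M, IsOpen U ∧ x ∈ U ∧ U ⊆ e.1.source ∩ f ⁻¹' e'.1.source ∧
      ∀ y ∈ U, ∀ z ∈ U,
        ((∀ j ∈ e.2, (e.1 y).val j = (e.1 z).val j) ↔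
          ∀ j ∈ e'.2, (e'.1 (f y)).val j = (e'.1 (f z)).val j)

end Foliation

/-! ## Chains and the Hausdorff leaf space -/

section Chains

variable {α : Type*}

/-- The infimum of `∑ d (c i) (c (i + 1))` over all finite sequences from `x` to `y`. -/
def chainEDist (d : α → α → ℝ≥0∞) (x y : α) : ℝ≥0∞ :=
  ⨅ (k : ℕ) (c : ℕ → α) (_ : c 0 = x) (_ : c k = y), ∑ i ∈ Finset.range k, d (c i) (c (i + 1))

theorem chainEDist_le {d : α → α → ℝ≥0∞} {x y : α} (k : ℕ) (c : ℕ → α) (h0 : c 0 = x)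
    (hk : c k = y) : chainEDist d x y ≤ ∑ i ∈ Finset.range k, d (c i) (c (i + 1)) :=
  iInf_le_of_le k <| iInf_le_of_le c <| iInf_le_of_le h0 <| iInf_le_of_le hk le_rfl

theorem chainEDist_self (d : α → α → ℝ≥0∞) (x : α) : chainEDist d x x = 0 := by
  simpa using chainEDist_le (d := d) 0 (fun _ => x) rfl rfl

theorem chainEDist_comm_le {d : α → α → ℝ≥0∞} (hd : ∀ x y, d x y = d y x) (x y : α) :
    chainEDist d x y ≤ chainEDist d y x := by
  conv_rhs => unfold chainEDist
  refine le_iInf fun k => le_iInf fun c => le_iInf fun h0 => le_iInf fun hk => ?_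
  refine (chainEDist_le k (fun i => c (k - i)) (by simpa using hk) (by simpa using h0)).trans ?_
  rw [← Finset.sum_range_reflect]
  refine Finset.sum_le_sum fun i hi => ?_
  rw [Finset.mem_range] at hi
  have h1 : k - (k - 1 - i) = i + 1 := by omega
  have h2 : k - (k - 1 - i + 1) = i := by omega
  rw [h1, h2, hd]

theorem chainEDist_triangle (d : α → α → ℝ≥0∞) (x y z : α) :
    chainEDist d x z ≤ chainEDist d x y + chainEDist d y z := by
  conv_rhs => unfold chainEDist
  simp only [ENNReal.iInf_add, ENNReal.add_iInf]
  refine le_iInf fun k' => le_iInf fun c' => le_iInf fun h0' => le_iInf fun hk' =>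
    le_iInf fun k => le_iInf fun c => le_iInf fun h0 => le_iInf fun hk => ?_
  have hc : ∀ i, k ≤ i → (if i ≤ k then c i else c' (i - k)) = c' (i - k) := by
    intro i hi
    split_ifs with h
    · obtain rfl : i = k := le_antisymm h hi
      simp [hk, h0']
    · rfl
  refine (chainEDist_le (k + k') (fun i => if i ≤ k then c i else c' (i - k)) (by simpa using h0)
    (by rw [hc _ (by omega)]; simpa using hk')).trans ?_
  rw [Finset.sum_range_add]
  refine add_le_add (Finset.sum_le_sum fun i hi => ?_) (Finset.sum_le_sum fun i _ => ?_)
  · rw [Finset.mem_range] at hi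
    rw [if_pos (by omega), if_pos (by omega)]
  · rw [hc _ (by omega), hc _ (by omega)]
    have h1 : k + i - k = i := by omega
    have h2 : k + i + 1 - k = i + 1 := by omega
    rw [h1, h2]

end Chains

namespace Foliation

variable {n : ℕ} [NeZero n] {q : ℕ} {r : ℕ∞ω} {M : Type*} [TopologicalSpace M]
  [ChartedSpace (EuclideanHalfSpace n) M] [RiemannianBundle (fun x : M => TangentSpace (𝓡∂ n) x)]

/-- The distance of two leaves, as subsets of the Riemannian manifold `M`. -/
def leafDist (F : Foliation n q r M) (L L' : F.LeafSpace) : ℝ≥0∞ :=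
  ⨅ x ∈ L.1, ⨅ y ∈ L'.1, riemannianEDist (𝓡∂ n) x y

theorem leafDist_comm (F : Foliation n q r M) (L L' : F.LeafSpace) :
    F.leafDist L L' = F.leafDist L' L := by
  unfold leafDist
  rw [iInf₂_comm]
  simp only [riemannianEDist_comm]

/-- The pseudo-metric `ρ` on the space of leaves: the infimum of the sums of the distances of
consecutive leaves over all finite sequences of leaves from `L` to `L'`. -/
instance (F : Foliation n q r M) : PseudoEMetricSpace F.LeafSpace where
  edist := chainEDist F.leafDist
  edist_self := chainEDist_self _
  edist_comm L L' := le_antisymm (chainEDist_comm_le F.leafDist_comm _ _)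
    (chainEDist_comm_le F.leafDist_comm _ _)
  edist_triangle := chainEDist_triangle _

/-- The Hausdorff leaf space: leaves with `ρ(L, L') = 0` are identified. -/
abbrev HLS (F : Foliation n q r M) : Type _ := SeparationQuotient F.LeafSpace

/-- The natural projection of `M` onto the Hausdorff leaf space. -/
def toHLS (F : Foliation n q r M) (x : M) : F.HLS := SeparationQuotient.mk (F.toLeafSpace x)

/-- The foliation is orthogonal to the subset `S` of the boundary: at each point of `S`, the vectors
orthogonal to the boundary are tangent to the foliation. -/
def IsOrthogonalTo (F : Foliation n q r M) (S : Set M) : Prop :=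
  ∀ x ∈ S, ∀ v : TangentSpace (𝓡∂ n) x,
    (∀ w : TangentSpace (𝓡∂ n) x,
      (show EuclideanSpace ℝ (Fin n) from
        mfderiv (𝓡∂ n) 𝓘(ℝ, EuclideanSpace ℝ (Fin n)) (extChartAt (𝓡∂ n) x) x w) 0 = 0 →
        inner ℝ v w = 0) →
    v ∈ F.tangentSpace x

end Foliation

/-! ## Boundary components and isometries between them -/

/-- `S` is a union of components of the boundary of `M`. -/
def IsUnionOfBoundaryComponents (n : ℕ) [NeZero n] {M : Type*} [TopologicalSpace M]
    [ChartedSpace (EuclideanHalfSpace n) M] (S : Set M) : Prop :=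
  S ⊆ (𝓡∂ n).boundary M ∧ ∀ x ∈ S, connectedComponentIn ((𝓡∂ n).boundary M) x ⊆ S

/-- The Riemannian distance of the submanifold `S` (with the metric induced from `M`): the infimum of
the lengths of the `C^1` curves lying in `S`. -/
def innerEDist (n : ℕ) [NeZero n] {M : Type*} [TopologicalSpace M]
    [ChartedSpace (EuclideanHalfSpace n) M] [RiemannianBundle (fun x : M => TangentSpace (𝓡∂ n) x)]
    (S : Set M) (x y : M) : ℝ≥0∞ :=
  ⨅ (γ : ℝ → M) (_ : ContMDiffOn 𝓘(ℝ) (𝓡∂ n) 1 γ (Icc 0 1)) (_ : γ 0 = x) (_ : γ 1 = y)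
    (_ : ∀ t ∈ Icc (0 : ℝ) 1, γ t ∈ S), pathELength (𝓡∂ n) γ 0 1

/-! ## Gluing -/

section Glue

variable {M₁ M₂ : Type*} {S₁ : Set M₁} {S₂ : Set M₂}

/-- The relation on `M₁ ⊔ M₂` identifying `x ∈ S₁` with `φ x ∈ S₂`. -/
inductive GlueRel (φ : S₁ → S₂) : M₁ ⊕ M₂ → M₁ ⊕ M₂ → Prop
  | glue (x : S₁) : GlueRel φ (Sum.inl x.1) (Sum.inr (φ x).1)

/-- The space `M₁ ∪_φ M₂`: the quotient of `M₁ ⊔ M₂` by the equivalence relation generated by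
`x ∼ φ x`. -/
def Glue (φ : S₁ → S₂) : Type _ := Quot (GlueRel φ)

instance [TopologicalSpace M₁] [TopologicalSpace M₂] (φ : S₁ → S₂) : TopologicalSpace (Glue φ) :=
  inferInstanceAs (TopologicalSpace (Quot (GlueRel φ)))

/-- The natural projection `p : M₁ ⊔ M₂ → M₁ ∪_φ M₂`. -/
def Glue.mk (φ : S₁ → S₂) (z : M₁ ⊕ M₂) : Glue φ := Quot.mk _ z

/-- The inclusion of `M₁` into `M₁ ∪_φ M₂`. -/
def Glue.inl (φ : S₁ → S₂) (x : M₁) : Glue φ := Glue.mk φ (Sum.inl x)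

/-- The inclusion of `M₂` into `M₁ ∪_φ M₂`. -/
def Glue.inr (φ : S₁ → S₂) (y : M₂) : Glue φ := Glue.mk φ (Sum.inr y)

end Glue

/-- `f : M → M'` is smooth and pulls the Riemannian metric of `M'` back to that of `M`. -/
def IsRiemannianInclusion (n : ℕ) [NeZero n] {M M' : Type*}
    [TopologicalSpace M] [ChartedSpace (EuclideanHalfSpace n) M]
    [RiemannianBundle (fun x : M => TangentSpace (𝓡∂ n) x)]
    [TopologicalSpace M'] [ChartedSpace (EuclideanHalfSpace n) M']
    [RiemannianBundle (fun x : M' => TangentSpace (𝓡∂ n) x)] (f : M → M') : Prop :=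
  ContMDiff (𝓡∂ n) (𝓡∂ n) ∞ f ∧
    ∀ (x : M) (v w : TangentSpace (𝓡∂ n) x),
      inner ℝ (mfderiv (𝓡∂ n) (𝓡∂ n) f x v) (mfderiv (𝓡∂ n) (𝓡∂ n) f x w) = inner ℝ v w

/-! ## Gluing metric spaces -/

/-- The disjoint union of two metric spaces, in which points of different pieces have
distance `∞`. -/
def DisjointUnion (A B : Type*) : Type _ := A ⊕ B

instance (A B : Type*) [PseudoEMetricSpace A] [PseudoEMetricSpace B] :
    PseudoEMetricSpace (DisjointUnion A B) where
  edist
    | Sum.inl a, Sum.inl a' => edist a a'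
    | Sum.inr b, Sum.inr b' => edist b b'
    | Sum.inl _, Sum.inr _ => ∞
    | Sum.inr _, Sum.inl _ => ∞
  edist_self := by
    rintro (a | b)
    · exact edist_self a
    · exact edist_self b
  edist_comm := by
    rintro (a | b) (a' | b')
    · exact edist_comm a a'
    · rfl
    · rfl
    · exact edist_comm b b'
  edist_triangle := by
    rintro (a | b) (a' | b') (a'' | b'')
    · exact edist_triangle a a' a''
    all_goals first | exact edist_triangle b b' b'' | simp

section QuotientMetric

variable {α : Type*}

/-- The set of equivalence classes of the smallest equivalence relation containing `R`. -/
def QuotientClasses (R : α → α → Prop) : Type _ := Quot R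

/-- The quotient pseudo-metric: the infimum of `∑ d(pᵢ, qᵢ)` over all finite sequences
`p₀, q₀, …, p_k, q_k` such that `p₀` is in the class `a`, `q_k` is in the class `b` and `qᵢ` is
equivalent to `pᵢ₊₁`. -/
def quotientEDist [PseudoEMetricSpace α] (R : α → α → Prop) (a b : QuotientClasses R) : ℝ≥0∞ :=
  ⨅ (k : ℕ) (p : ℕ → α) (q : ℕ → α) (_ : Quot.mk R (p 0) = a) (_ : Quot.mk R (q k) = b)
    (_ : ∀ i < k, Quot.mk R (q i) = Quot.mk R (p (i + 1))),
    ∑ i ∈ Finset.range (k + 1), edist (p i) (q i)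

theorem quotientEDist_le [PseudoEMetricSpace α] {R : α → α → Prop} {a b : QuotientClasses R}
    (k : ℕ) (p q : ℕ → α) (h0 : Quot.mk R (p 0) = a) (hk : Quot.mk R (q k) = b)
    (h : ∀ i < k, Quot.mk R (q i) = Quot.mk R (p (i + 1))) :
    quotientEDist R a b ≤ ∑ i ∈ Finset.range (k + 1), edist (p i) (q i) :=
  iInf_le_of_le k <| iInf_le_of_le p <| iInf_le_of_le q <| iInf_le_of_le h0 <|
    iInf_le_of_le hk <| iInf_le_of_le h le_rfl

theorem quotientEDist_comm_le [PseudoEMetricSpace α] (R : α → α → Prop)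
    (a b : QuotientClasses R) : quotientEDist R a b ≤ quotientEDist R b a := by
  conv_rhs => unfold quotientEDist
  refine le_iInf fun k => le_iInf fun p => le_iInf fun q => le_iInf fun h0 => le_iInf fun hk =>
    le_iInf fun h => ?_
  refine (quotientEDist_le k (fun i => q (k - i)) (fun i => p (k - i)) (by simpa using hk)
    (by simpa using h0) ?_).trans ?_
  · intro i hi
    have h1 : k - i = k - (i + 1) + 1 := by omega
    rw [h1]
    exact (h _ (by omega)).symm
  · rw [← Finset.sum_range_reflect]
    refine Finset.sum_le_sum fun i hi => ?_
    rw [Finset.mem_range] at hi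
    have h1 : k - (k + 1 - 1 - i) = i := by omega
    rw [h1, edist_comm]

theorem quotientEDist_triangle [PseudoEMetricSpace α] (R : α → α → Prop)
    (a b c : QuotientClasses R) :
    quotientEDist R a c ≤ quotientEDist R a b + quotientEDist R b c := by
  conv_rhs => unfold quotientEDist
  simp only [ENNReal.iInf_add, ENNReal.add_iInf]
  refine le_iInf fun k' => le_iInf fun p' => le_iInf fun q' => le_iInf fun h0' =>
    le_iInf fun hk' => le_iInf fun h' => le_iInf fun k => le_iInf fun p => le_iInf fun q =>
    le_iInf fun h0 => le_iInf fun hk => le_iInf fun h => ?_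
  refine (quotientEDist_le (k + 1 + k') (fun i => if i ≤ k then p i else p' (i - (k + 1)))
    (fun i => if i ≤ k then q i else q' (i - (k + 1))) (by simpa using h0) ?_ ?_).trans ?_
  · rw [if_neg (by omega), Nat.add_sub_cancel_left]
    exact hk'
  · intro i hi
    rcases lt_trichotomy i k with hik | rfl | hik
    · rw [if_pos hik.le, if_pos (by omega)]
      exact h i hik
    · rw [if_pos le_rfl, if_neg (by omega), Nat.sub_self, hk, h0']
    · rw [if_neg (by omega), if_neg (by omega)]
      have h1 : i + 1 - (k + 1) = i - (k + 1) + 1 := by omega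
      rw [h1]
      exact h' _ (by omega)
  · have h1 : k + 1 + k' + 1 = (k + 1) + (k' + 1) := by omega
    rw [h1, Finset.sum_range_add]
    refine add_le_add (Finset.sum_le_sum fun i hi => ?_) (Finset.sum_le_sum fun i _ => ?_)
    · rw [Finset.mem_range] at hi
      rw [if_pos (by omega), if_pos (by omega)]
    · rw [if_neg (by omega), if_neg (by omega), Nat.add_sub_cancel_left]

instance [PseudoEMetricSpace α] (R : α → α → Prop) : PseudoEMetricSpace (QuotientClasses R) where
  edist := quotientEDist R
  edist_self a := by
    obtain ⟨x, rfl⟩ := Quot.exists_rep a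
    have h : quotientEDist R (Quot.mk R x) (Quot.mk R x) ≤ _ :=
      quotientEDist_le 0 (fun _ => x) (fun _ => x) rfl rfl (by simp)
    simpa using h
  edist_comm a b := le_antisymm (quotientEDist_comm_le R a b) (quotientEDist_comm_le R b a)
  edist_triangle := quotientEDist_triangle R

/-- The quotient metric space: classes at distance zero are identified. -/
abbrev QuotientMetricSpace [PseudoEMetricSpace α] (R : α → α → Prop) : Type _ :=
  SeparationQuotient (QuotientClasses R)

/-- The natural projection onto the quotient metric space. -/
def QuotientMetricSpace.mk [PseudoEMetricSpace α] (R : α → α → Prop) (x : α) :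
    QuotientMetricSpace R :=
  SeparationQuotient.mk (X := QuotientClasses R) (Quot.mk R x)

end QuotientMetric

/-! ## Gluing Hausdorff leaf spaces -/

section GlueHLS

variable {n : ℕ} [NeZero n] {q : ℕ} {r : ℕ∞ω} {M₁ M₂ : Type*}
  [TopologicalSpace M₁] [ChartedSpace (EuclideanHalfSpace n) M₁]
  [RiemannianBundle (fun x : M₁ => TangentSpace (𝓡∂ n) x)]
  [TopologicalSpace M₂] [ChartedSpace (EuclideanHalfSpace n) M₂]
  [RiemannianBundle (fun x : M₂ => TangentSpace (𝓡∂ n) x)]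
  {S₁ : Set M₁} {S₂ : Set M₂}

/-- The natural projection of `M₁ ⊔ M₂` onto `HLS(F₁) ⊔ HLS(F₂)`. -/
def toHLSUnion (F₁ : Foliation n q r M₁) (F₂ : Foliation n q r M₂) :
    M₁ ⊕ M₂ → DisjointUnion F₁.HLS F₂.HLS :=
  Sum.map F₁.toHLS F₂.toHLS

/-- The relation `π(x) ∼ π(φ x)`, `x ∈ S₁`, on `HLS(F₁) ⊔ HLS(F₂)`. -/
inductive HLSGlueRel (F₁ : Foliation n q r M₁) (F₂ : Foliation n q r M₂) (φ : S₁ → S₂) :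
    DisjointUnion F₁.HLS F₂.HLS → DisjointUnion F₁.HLS F₂.HLS → Prop
  | glue (x : S₁) : HLSGlueRel F₁ F₂ φ (toHLSUnion F₁ F₂ (Sum.inl x.1))
      (toHLSUnion F₁ F₂ (Sum.inr (φ x).1))

/-- The metric space obtained by gluing `HLS(F₁)` and `HLS(F₂)` along the smallest equivalence
relation containing `π(x) ∼ π(φ x)`, `x ∈ S₁`. -/
abbrev GluedHLS (F₁ : Foliation n q r M₁) (F₂ : Foliation n q r M₂) (φ : S₁ → S₂) : Type _ :=
  QuotientMetricSpace (HLSGlueRel F₁ F₂ φ)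

/-- The natural projection of `HLS(F₁) ⊔ HLS(F₂)` onto the glued space. -/
def toGluedHLS (F₁ : Foliation n q r M₁) (F₂ : Foliation n q r M₂) (φ : S₁ → S₂)
    (a : DisjointUnion F₁.HLS F₂.HLS) : GluedHLS F₁ F₂ φ :=
  QuotientMetricSpace.mk _ a

end GlueHLS

end

/-!
Two points of `M = M₁ ∪_φ M₂` have the same distance in `HLS(F)` and in the glued space `X`; as both
spaces are quotients of `M₁ ⊔ M₂`, this gives the isometry (`exists_isometryEquiv_of_edist_eq`).

The distance of `HLS(F)` is at most that of `X` because the inclusions `M_i → M` send leaves into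
leaves (`Foliation.RestrictsTo.leaf_map_eq`) and do not increase Riemannian distances
(`IsRiemannianInclusion.riemannianEDist_le`); hence they induce `1`-Lipschitz maps of Hausdorff leaf
spaces, which agree on the seam.

For the converse, the map `f : M → X` induced by the projections of the two pieces has to be
constant on leaves and `1`-Lipschitz for the Riemannian distance of `M`
(`Foliation.edist_le_edist_toHLS`). Both properties are local, and a local property of `M` can be
checked on `M₁` and `M₂` separately (`Glue.eventually_nhds`); this uses that `S₁` and `S₂`, being
unions of components of the locally connected boundaries, are closed.

* Near a point, a slice of `F` meets each `M_i` in a slice of `F_i`, and small slices are connected.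
  So `f` is locally constant in the leaf topology, hence constant on leaves.
* A short curve of `M` may cross the seam infinitely often, so it cannot simply be cut into
  pieces lying in `M₁` and `M₂`. Instead, only the first order behaviour of `f` is used. Up to
  factors arbitrarily close to `1`, the distance of `M_i` from a point `x` is at most the distance
  in a chart of `M_i`, measured in the norm of the tangent space at `x`
  (`eventually_riemannianEDist_le_chartEDist`), and as the derivative of the inclusion is isometric,
  this is at most the distance in a chart of `M` (`eventually_chartEDist_le_chartEDist_map`). The
  latter is controlled by the lengths of short curves of `M`, and the local bounds add up along
  a curve (`edist_le_riemannianEDist_of_eventually`).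
-/

section

open Filter Topology

/-! ### Slices of charts -/

section Slice

variable {n : ℕ} [NeZero n] {M : Type*} [TopologicalSpace M]

theorem EuclideanHalfSpace.isPreconnected_ball_inter_slice (a : EuclideanSpace ℝ (Fin n)) (ε : ℝ)
    (J : Finset (Fin n)) :
    IsPreconnected {h : EuclideanHalfSpace n |
      h.val ∈ Metric.ball a ε ∧ ∀ j ∈ J, h.val j = a j} := by
  have hind : Topology.IsInducing (Subtype.val : EuclideanHalfSpace n → EuclideanSpace ℝ (Fin n)) :=
    Topology.IsInducing.subtypeVal
  rw [← hind.isPreconnected_image]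
  have heq : Subtype.val '' {h : EuclideanHalfSpace n | h.val ∈ Metric.ball a ε ∧
      ∀ j ∈ J, h.val j = a j} =
      (Metric.ball a ε ∩ {v | 0 ≤ v 0}) ∩ ⋂ j ∈ J, {v | v j = a j} := by
    ext v
    simp only [mem_image, mem_ofPred_eq, mem_inter_iff, mem_iInter]
    constructor
    · rintro ⟨h, ⟨h1, h2⟩, rfl⟩
      exact ⟨⟨h1, h.2⟩, h2⟩
    · rintro ⟨⟨h1, h2⟩, h3⟩
      exact ⟨⟨v, h2⟩, ⟨h1, h3⟩, rfl⟩
  rw [heq]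
  refine Convex.isPreconnected ?_
  refine ((convex_ball a ε).inter ?_).inter (convex_iInter₂ fun j _ => ?_)
  · exact convex_halfSpace_ge (f := fun v : EuclideanSpace ℝ (Fin n) => v 0)
      ⟨fun _ _ => rfl, fun _ _ => rfl⟩ 0
  · exact convex_hyperplane (f := fun v : EuclideanSpace ℝ (Fin n) => v j)
      ⟨fun _ _ => rfl, fun _ _ => rfl⟩ (a j)

/-- Slices of a half-space chart contain a connected neighbourhood `K` of each of their points,
because balls of the half-space are convex. -/
theorem OpenPartialHomeomorph.exists_isPreconnected_slice
    (e : OpenPartialHomeomorph M (EuclideanHalfSpace n)) {x : M} (hx : x ∈ e.source)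
    (J : Finset (Fin n)) :
    ∃ K ⊆ e.target, IsPreconnected K ∧ e x ∈ K ∧ (∀ h ∈ K, ∀ j ∈ J, h.val j = (e x).val j) ∧
      ∀ᶠ y in 𝓝 x, (∀ j ∈ J, (e y).val j = (e x).val j) → e y ∈ K := by
  obtain ⟨O, hO, hOt⟩ := isOpen_induced_iff.1 e.open_target
  have hxO : (e x).val ∈ O := by
    have := e.map_source hx
    rw [← hOt] at this
    exact this
  obtain ⟨ε, hε, hball⟩ := Metric.isOpen_iff.1 hO _ hxO
  refine ⟨_, fun h hh => ?_, EuclideanHalfSpace.isPreconnected_ball_inter_slice (e x).val ε J,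
    ⟨Metric.mem_ball_self hε, fun _ _ => rfl⟩, fun h hh => hh.2, ?_⟩
  · rw [← hOt]
    exact hball hh.1
  · have hev : ∀ᶠ y in 𝓝 x, (e y).val ∈ Metric.ball (e x).val ε :=
      (continuous_subtype_val.continuousAt.comp (e.continuousAt hx)) (Metric.ball_mem_nhds _ hε)
    filter_upwards [hev] with y hy hys
    exact ⟨hy, hys⟩

end Slice

/-! ### Boundary components and the topology of the glued space -/

section Boundary

variable {n : ℕ} [NeZero n] {M : Type*} [TopologicalSpace M]
  [ChartedSpace (EuclideanHalfSpace n) M]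

/-- In a chart the boundary is a hyperplane, so near each of its points it is connected. -/
theorem eventually_mem_connectedComponentIn_boundary [IsManifold (𝓡∂ n) ∞ M] {x : M}
    (hx : x ∈ (𝓡∂ n).boundary M) :
    ∀ᶠ y in 𝓝 x, y ∈ (𝓡∂ n).boundary M →
      x ∈ connectedComponentIn ((𝓡∂ n).boundary M) y := by
  set e := chartAt (EuclideanHalfSpace n) x
  have hxe : x ∈ e.source := mem_chart_source _ x
  have hbd : ∀ y ∈ e.source, y ∈ (𝓡∂ n).boundary M ↔ (e y).val 0 = 0 := by
    intro y hy
    have h1 := (𝓡∂ n).isInteriorPoint_iff_of_mem_atlas (M := M) (n := ∞) (by simp)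
      (chart_mem_atlas (EuclideanHalfSpace n) x) hy
    have h2 : (e.extend (𝓡∂ n)) y ∈ interior (e.extend (𝓡∂ n)).target ↔ 0 < (e y).val 0 := by
      have hr : (e.extend (𝓡∂ n)) y ∈ interior (range (𝓡∂ n)) ↔ 0 < (e y).val 0 := by
        rw [interior_range_modelWithCornersEuclideanHalfSpace]
        rfl
      rw [← hr]
      exact ⟨fun h => e.interior_extend_target_subset_interior_range h,
        fun h => e.mem_interior_extend_target (e.map_source hy) h⟩
    have h3 : (𝓡∂ n).IsInteriorPoint y ↔ 0 < (e y).val 0 := h1.trans h2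
    change (𝓡∂ n).IsBoundaryPoint y ↔ _
    rw [(𝓡∂ n).isBoundaryPoint_iff_not_isInteriorPoint, h3, not_lt]
    exact ⟨fun h => le_antisymm h (e y).2, le_of_eq⟩
  -- the boundary is the slice of the chart through `x` with transverse coordinate `0`
  have hx0 : (e x).val 0 = 0 := (hbd x hxe).1 hx
  obtain ⟨K, hKt, hK, hxK, hKs, hev⟩ := e.exists_isPreconnected_slice hxe {0}
  have hpre : IsPreconnected (e.symm '' K) := hK.image _ (e.continuousOn_symm.mono hKt)
  have hsub : e.symm '' K ⊆ (𝓡∂ n).boundary M := by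
    rintro _ ⟨h, hh, rfl⟩
    rw [hbd _ (e.map_target (hKt hh)), e.right_inv (hKt hh)]
    exact (hKs h hh 0 (Finset.mem_singleton_self 0)).trans hx0
  filter_upwards [hev, e.open_source.mem_nhds hxe] with y hy hye hyb
  refine hpre.subset_connectedComponentIn ⟨e y, hy ?_, e.left_inv hye⟩ hsub
    ⟨e x, hxK, e.left_inv hxe⟩
  simpa [hx0] using (hbd y hye).1 hyb

theorem IsUnionOfBoundaryComponents.isClosed [IsManifold (𝓡∂ n) ∞ M] {S : Set M}
    (hS : IsUnionOfBoundaryComponents n S) : IsClosed S := by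
  refine isClosed_of_closure_subset fun x hx => ?_
  have hb : IsClosed ((𝓡∂ n).boundary M) := (𝓡∂ n).isClosed_boundary (n := ∞) (by simp)
  have hxb : x ∈ (𝓡∂ n).boundary M := closure_minimal hS.1 hb hx
  obtain ⟨y, hy, hyS⟩ :=
    mem_closure_iff_nhds.1 hx _ (eventually_mem_connectedComponentIn_boundary hxb)
  exact hS.2 y hyS (hy (hS.1 hyS))

end Boundary

section GlueTopology

variable {M₁ M₂ : Type*} {S₁ : Set M₁} {S₂ : Set M₂}

theorem Glue.mk_eq_mk_iff {φ : S₁ → S₂} (hφ : Function.Injective φ) {z w : M₁ ⊕ M₂} :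
    Glue.mk φ z = Glue.mk φ w ↔ z = w ∨ GlueRel φ z w ∨ GlueRel φ w z := by
  constructor
  · intro h
    replace h := Quot.eqvGen_exact h
    induction h with
    | rel _ _ h => exact Or.inr (Or.inl h)
    | refl => exact Or.inl rfl
    | symm _ _ _ ih => tauto
    | trans a b c _ _ ih ih' =>
      rcases ih with rfl | ⟨⟨x⟩⟩ | ⟨⟨x⟩⟩
      · exact ih'
      · rcases ih' with rfl | h | h
        · exact Or.inr (Or.inl ⟨x⟩)
        · cases h
        · generalize hb : (Sum.inr (φ x).1 : M₁ ⊕ M₂) = b at h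
          obtain ⟨y⟩ := h
          obtain rfl : x = y := hφ (Subtype.ext (Sum.inr_injective hb))
          exact Or.inl rfl
      · rcases ih' with rfl | h | h
        · exact Or.inr (Or.inr ⟨x⟩)
        · generalize hb : (Sum.inl x.1 : M₁ ⊕ M₂) = b at h
          obtain ⟨y⟩ := h
          obtain rfl : x = y := Subtype.ext (Sum.inl_injective hb)
          exact Or.inl rfl
        · cases h
  · rintro (rfl | h | h)
    · rfl
    · exact Quot.sound h
    · exact (Quot.sound h).symm

variable [TopologicalSpace M₁] [TopologicalSpace M₂]

theorem Glue.isClosedMap_mk (hS₁ : IsClosed S₁) (hS₂ : IsClosed S₂) (φ : S₁ ≃ₜ S₂) :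
    IsClosedMap (Glue.mk φ) := by
  intro C hC
  have hq : Topology.IsQuotientMap (Glue.mk φ) := isQuotientMap_quot_mk
  rw [← hq.isClosed_preimage]
  obtain ⟨h1, h2⟩ := isClosed_sum_iff.1 hC
  -- the saturation of `C` adds the partners of the points of `C` that lie on the seam
  have key : Glue.mk φ ⁻¹' (Glue.mk φ '' C) =
      C ∪ Sum.inr '' ((fun x : S₁ => (φ x).1) '' {x : S₁ | Sum.inl x.1 ∈ C}) ∪
        Sum.inl '' ((fun y : S₂ => (φ.symm y).1) '' {y : S₂ | Sum.inr y.1 ∈ C}) := by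
    ext z
    constructor
    · rintro ⟨w, hw, hwz⟩
      rcases (Glue.mk_eq_mk_iff φ.injective).1 hwz with rfl | ⟨⟨x⟩⟩ | ⟨⟨x⟩⟩
      · exact Or.inl (Or.inl hw)
      · exact Or.inl (Or.inr ⟨_, ⟨x, hw, rfl⟩, rfl⟩)
      · exact Or.inr ⟨_, ⟨φ x, hw, rfl⟩, by simp⟩
    · rintro ((hz | ⟨_, ⟨x, hx, rfl⟩, rfl⟩) | ⟨_, ⟨y, hy, rfl⟩, rfl⟩)
      · exact ⟨z, hz, rfl⟩
      · exact ⟨_, hx, Quot.sound ⟨x⟩⟩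
      · refine ⟨_, hy, (Quot.sound ?_).symm⟩
        simpa using GlueRel.glue (φ := φ) (φ.symm y)
  rw [key]
  refine (hC.union (isClosedMap_inr _ ?_)).union (isClosedMap_inl _ ?_)
  · exact (hS₂.isClosedMap_subtype_val.comp φ.isClosedMap) _ (h1.preimage continuous_subtype_val)
  · exact (hS₁.isClosedMap_subtype_val.comp φ.symm.isClosedMap) _
      (h2.preimage continuous_subtype_val)

/-- A local property of the glued space can be checked on the two pieces. -/
theorem Glue.eventually_nhds (hS₁ : IsClosed S₁) (hS₂ : IsClosed S₂) (φ : S₁ ≃ₜ S₂) {a : Glue φ}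
    {P : Glue φ → Prop} (h₁ : ∀ x, Glue.inl φ x = a → ∀ᶠ y in 𝓝 x, P (Glue.inl φ y))
    (h₂ : ∀ x, Glue.inr φ x = a → ∀ᶠ y in 𝓝 x, P (Glue.inr φ y)) : ∀ᶠ b in 𝓝 a, P b := by
  have h := (Glue.isClosedMap_mk hS₁ hS₂ φ).eventually_nhds_fiber
    (p := fun z => P (Glue.mk φ z)) a ?_
  · filter_upwards [h] with b hb
    obtain ⟨z, rfl⟩ := Quot.exists_rep b
    exact hb z rfl
  · rintro (x | x) hx
    · rw [nhds_inl]
      exact h₁ x hx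
    · rw [nhds_inr]
      exact h₂ x hx

end GlueTopology

/-! ### Leaves of a foliation and of its restrictions -/

namespace Foliation

variable {n : ℕ} [NeZero n] {q : ℕ} {r : ℕ∞ω} {M : Type*} [TopologicalSpace M]
  [ChartedSpace (EuclideanHalfSpace n) M]

theorem leaf_eq_of_mem (F : Foliation n q r M) {x y : M} (h : y ∈ F.leaf x) :
    F.leaf y = F.leaf x :=
  (@connectedComponent_eq M F.leafTopology x y h).symm

theorem mem_leaf (F : Foliation n q r M) (x : M) : x ∈ F.leaf x :=
  @mem_connectedComponent M F.leafTopology x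

/-- Small slices are convex in the chart, hence connected. -/
theorem eventually_leaf_eq_of_mem_chartSlice (F : Foliation n q r M)
    {e : OpenPartialHomeomorph M (EuclideanHalfSpace n) × Finset (Fin n)} (he : e ∈ F.atlas)
    {x : M} (hx : x ∈ e.1.source) :
    ∀ᶠ y in 𝓝 x, y ∈ chartSlice e x → F.leaf y = F.leaf x := by
  obtain ⟨K, hKt, hK, hxK, hKs, hev⟩ := e.1.exists_isPreconnected_slice hx e.2
  have : PreconnectedSpace K := Subtype.preconnectedSpace hK
  let σ : K → chartSlice e x := fun h => ⟨e.1.symm h, e.1.map_target (hKt h.2), fun j hj => by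
    rw [e.1.right_inv (hKt h.2)]
    exact hKs h h.2 j hj⟩
  have hσ : Continuous σ :=
    (e.1.continuousOn_symm.mono hKt).domRestrict.subtype_mk _
  have hσ' : @Continuous K M _ F.leafTopology fun h => (σ h : M) :=
    @Continuous.mk _ _ _ F.leafTopology _ fun U hU => (hU e he x hx).preimage hσ
  have hconn := @isPreconnected_range K M _ F.leafTopology _ _ hσ'
  filter_upwards [hev] with y hy hys
  have hsub := @IsPreconnected.subset_connectedComponent M F.leafTopology x _ hconn
    ⟨⟨e.1 x, hxK⟩, e.1.left_inv hx⟩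
  exact F.leaf_eq_of_mem (hsub ⟨⟨e.1 y, hy hys.2⟩, e.1.left_inv hys.1⟩)

/-- A set is open in the leaf topology if locally each slice is contained in it. -/
theorem isOpen_leafTopology_of_eventually (F : Foliation n q r M) {U : Set M}
    (h : ∀ e ∈ F.atlas, ∀ x ∈ e.1.source, x ∈ U → ∀ᶠ y in 𝓝 x, y ∈ chartSlice e x → y ∈ U) :
    IsOpen[F.leafTopology] U := by
  intro e he x hx
  rw [isOpen_iff_mem_nhds]
  intro y hy
  have h1 := h e he y y.2.1 hy
  have h2 := continuous_subtype_val.continuousAt (x := y) h1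
  filter_upwards [h2] with z hz
  exact hz ⟨z.2.1, fun j hj => (z.2.2 j hj).trans (y.2.2 j hj).symm⟩

theorem eventually_mem_of_isOpen_leafTopology (F : Foliation n q r M) {U : Set M}
    (hU : IsOpen[F.leafTopology] U)
    {e : OpenPartialHomeomorph M (EuclideanHalfSpace n) × Finset (Fin n)} (he : e ∈ F.atlas)
    {x : M} (hx : x ∈ e.1.source) (hxU : x ∈ U) : ∀ᶠ y in 𝓝 x, y ∈ chartSlice e x → y ∈ U := by
  obtain ⟨O, hO, hOU⟩ := isOpen_induced_iff.1 (hU e he x hx)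
  have hx' : x ∈ chartSlice e x := ⟨hx, fun _ _ => rfl⟩
  have hxO : (⟨x, hx'⟩ : chartSlice e x) ∈ Subtype.val ⁻¹' O := by
    rw [hOU]
    exact hxU
  filter_upwards [hO.mem_nhds hxO] with y hy hys
  have : (⟨y, hys⟩ : chartSlice e x) ∈ Subtype.val ⁻¹' O := hy
  rw [hOU] at this
  exact this

section Restriction

variable {r' : ℕ∞ω} {M' : Type*} [TopologicalSpace M'] [ChartedSpace (EuclideanHalfSpace n) M']
  {F' : Foliation n q r' M'} {F : Foliation n q r M} {f : M → M'}

theorem RestrictsTo.continuous_leafTopology (h : F'.RestrictsTo F f) (hf : Continuous f) :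
    @Continuous M M' F.leafTopology F'.leafTopology f := by
  refine @Continuous.mk _ _ F.leafTopology F'.leafTopology _ fun U hU => ?_
  refine F.isOpen_leafTopology_of_eventually fun e he x hx hxU => ?_
  obtain ⟨e', he', hfx⟩ := F'.exists_chart (f x)
  obtain ⟨V, hVo, hxV, hV, hVs⟩ := h x e he hx e' he' hfx
  filter_upwards [hVo.mem_nhds hxV, hf.continuousAt (x := x)
    (F'.eventually_mem_of_isOpen_leafTopology hU he' hfx hxU)] with y hyV hy hys
  exact hy ⟨(hV hyV).2, (hVs y hyV x hxV).1 hys.2⟩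

theorem RestrictsTo.leaf_map_eq (h : F'.RestrictsTo F f) (hf : Continuous f) {x y : M}
    (hxy : F.leaf x = F.leaf y) : F'.leaf (f x) = F'.leaf (f y) := by
  have h1 := @Continuous.image_connectedComponent_subset _ _ F.leafTopology F'.leafTopology _
    (h.continuous_leafTopology hf) y
  refine F'.leaf_eq_of_mem (h1 ⟨x, ?_, rfl⟩)
  change x ∈ F.leaf y
  rw [← hxy]
  exact F.mem_leaf x

theorem RestrictsTo.eventually_leaf_eq (h : F'.RestrictsTo F f)
    {e' : OpenPartialHomeomorph M' (EuclideanHalfSpace n) × Finset (Fin n)} (he' : e' ∈ F'.atlas)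
    {x : M} (hx : f x ∈ e'.1.source) :
    ∀ᶠ y in 𝓝 x, f y ∈ chartSlice e' (f x) → F.leaf y = F.leaf x := by
  obtain ⟨e, he, hxe⟩ := F.exists_chart x
  obtain ⟨V, hVo, hxV, hV, hVs⟩ := h x e he hxe e' he' hx
  filter_upwards [hVo.mem_nhds hxV, F.eventually_leaf_eq_of_mem_chartSlice he hxe] with y hyV hy hys
  exact hy ⟨(hV hyV).1, (hVs y hyV x hxV).2 hys.2⟩

end Restriction

/-- A function that is locally constant along the slices is constant on leaves. -/
theorem eq_of_leaf_eq_of_eventually (F : Foliation n q r M) {X : Type*} {f : M → X}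
    (h : ∀ e ∈ F.atlas, ∀ x ∈ e.1.source, ∀ᶠ y in 𝓝 x, y ∈ chartSlice e x → f y = f x)
    {x y : M} (hxy : F.leaf x = F.leaf y) : f x = f y := by
  have hf : @IsLocallyConstant M X F.leafTopology f := fun s =>
    F.isOpen_leafTopology_of_eventually fun e he z hz hzs => by
      filter_upwards [h e he z hz] with w hw hws
      rw [mem_preimage, hw hws]
      exact hzs
  refine @IsLocallyConstant.apply_eq_of_isPreconnected M X F.leafTopology f hf (F.leaf y)
    (@isPreconnected_connectedComponent M F.leafTopology y) x y ?_ (F.mem_leaf y)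
  rw [← hxy]
  exact F.mem_leaf x

end Foliation

/-! ### First order comparison of the Riemannian distance with charts -/

theorem Bundle.IsContinuousRiemannianBundle.of_contMDiff {EB HB B F : Type*} [NormedAddCommGroup EB]
    [NormedSpace ℝ EB] [TopologicalSpace HB] (IB : ModelWithCorners ℝ EB HB) [TopologicalSpace B]
    [ChartedSpace HB B] [NormedAddCommGroup F] [NormedSpace ℝ F] {E : B → Type*}
    [TopologicalSpace (TotalSpace F E)] [∀ x, NormedAddCommGroup (E x)]
    [∀ x, InnerProductSpace ℝ (E x)] [FiberBundle F E] [VectorBundle ℝ F E] {k : ℕ∞ω}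
    [h : IsContMDiffRiemannianBundle IB k F E] : IsContinuousRiemannianBundle F E := by
  obtain ⟨g, hg, hg'⟩ := h.exists_contMDiff
  exact ⟨g, hg.continuous, hg'⟩

section Riemannian

open MeasureTheory
open scoped NNReal

theorem enorm_le_mul_enorm_of_norm_le {F G : Type*} [SeminormedAddCommGroup F]
    [SeminormedAddCommGroup G] {a : F} {b : G} {r : ℝ≥0} (h : ‖a‖ ≤ r * ‖b‖) :
    ‖a‖ₑ ≤ r * ‖b‖ₑ := by
  have h' : ‖a‖₊ ≤ r * ‖b‖₊ := h
  rw [enorm_eq_nnnorm, enorm_eq_nnnorm]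
  exact_mod_cast h'

variable {E : Type*} [NormedAddCommGroup E] [NormedSpace ℝ E] {H : Type*} [TopologicalSpace H]
  {I : ModelWithCorners ℝ E H} {M : Type*} [TopologicalSpace M] [ChartedSpace H M]
  [IsManifold I 1 M]

variable (I) in
/-- The tangent vector at `x` with given coordinates in the preferred chart at `x`. -/
noncomputable def tangentOfChart (x : M) : E →L[ℝ] TangentSpace I x :=
  (trivializationAt E (TangentSpace I) x).symmL ℝ x

theorem tangentOfChart_mfderiv (x : M) (v : TangentSpace I x) :
    tangentOfChart I x (mfderiv I 𝓘(ℝ, E) (extChartAt I x) x v) = v := by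
  have hx := mem_chart_source H x
  have h := (trivializationAt E (TangentSpace I) x).symmL_continuousLinearMapAt (R := ℝ)
    (FiberBundle.mem_baseSet_trivializationAt' x) v
  rw [TangentBundle.continuousLinearMapAt_trivializationAt hx] at h
  exact h

theorem mfderiv_tangentOfChart (x : M) (w : E) :
    mfderiv I 𝓘(ℝ, E) (extChartAt I x) x (tangentOfChart I x w) = w := by
  have hx := mem_chart_source H x
  have h := (trivializationAt E (TangentSpace I) x).continuousLinearMapAt_symmL (R := ℝ)
    (FiberBundle.mem_baseSet_trivializationAt' x) w
  rw [TangentBundle.continuousLinearMapAt_trivializationAt hx] at h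
  exact h

/-- In Mathlib `TangentSpace I x` is `E` by definition, identified through the chart at `x`; the
coordinates of a tangent vector at `x` are the vector itself. -/
theorem tangentOfChart_eq (x : M) (w : E) :
    tangentOfChart I x w = (show TangentSpace I x from w) := by
  have h := mfderiv_tangentOfChart (I := I) x w
  rw [mfderiv_extChartAt_self] at h
  exact h

variable [RiemannianBundle (fun x : M => TangentSpace I x)]

variable (I) in
/-- The norm in `T_x M` of the difference of `y` and `x` in the preferred chart at `x`: the first
order approximation of the Riemannian distance from `x`. It is meaningful for `y` near `x` only. -/
noncomputable def chartEDist (x y : M) : ℝ≥0∞ :=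
  ‖tangentOfChart I x (extChartAt I x y - extChartAt I x x)‖ₑ

/-- A map whose derivative at `x` preserves the norm of tangent vectors does not shrink distances in
charts near `x`, up to a factor close to `1`. -/
theorem eventually_chartEDist_le_chartEDist_map {H' : Type*} [TopologicalSpace H']
    {I' : ModelWithCorners ℝ E H'}
    {M' : Type*} [TopologicalSpace M'] [ChartedSpace H' M'] [IsManifold I' 1 M']
    [RiemannianBundle (fun x : M' => TangentSpace I' x)]
    {f : M → M'} {x : M} (hf : MDifferentiableAt I I' f x)
    (hiso : ∀ v : TangentSpace I x, ‖mfderiv I I' f x v‖ = ‖v‖) {r : ℝ≥0} (hr : 1 < r) :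
    ∀ᶠ y in 𝓝 x, chartEDist I x y ≤ r * chartEDist I' (f x) (f y) := by
  set A := tangentOfChart I x
  set B := tangentOfChart I' (f x)
  set e := extChartAt I x
  set e' := extChartAt I' (f x)
  let T : TangentSpace I x →L[ℝ] E := mfderiv I 𝓘(ℝ, E) e x
  have hTA : ∀ w : E, T (A w) = w := mfderiv_tangentOfChart x
  -- `c` bounds the error of the linear approximation of `f` relative to `‖e y - e x‖`; in the norm
  -- of `T_x M` the relative error is then at most `‖B‖ * (c * ‖T‖)`
  obtain ⟨c, hc, hcr⟩ : ∃ c : ℝ, 0 < c ∧ r * (1 - ‖B‖ * (c * ‖T‖)) ≥ 1 := by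
    have hr' : (1 : ℝ) < r := by exact_mod_cast hr
    have ht : Tendsto (fun c : ℝ => r * (1 - ‖B‖ * (c * ‖T‖))) (𝓝[>] 0)
        (𝓝 (r * (1 - ‖B‖ * (0 * ‖T‖)))) :=
      (Continuous.tendsto (by fun_prop) 0).mono_left nhdsWithin_le_nhds
    have := (ht.eventually_const_le (u := 1) (by simpa using hr')).and self_mem_nhdsWithin
    obtain ⟨c, h1, h2⟩ := this.exists
    exact ⟨c, h2, h1⟩
  have h1 : HasMFDerivAt I 𝓘(ℝ, E) (e' ∘ f) x
      ((mfderiv I' 𝓘(ℝ, E) e' (f x)).comp (mfderiv I I' f x)) :=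
    (mdifferentiableAt_extChartAt (mem_chart_source H' (f x))).hasMFDerivAt.comp x hf.hasMFDerivAt
  have h2 := h1.2.isLittleO.def hc
  have h3 : Tendsto e (𝓝 x) (𝓝[range I] (e x)) := (map_extChartAt_nhds x).le
  filter_upwards [h3.eventually h2, extChartAt_source_mem_nhds (I := I) x] with y hy hys
  set D : E →L[ℝ] E := (mfderiv I' 𝓘(ℝ, E) e' (f x)).comp (mfderiv I I' f x)
  have hy' : ‖(e' (f y) - e' (f x)) - D (e y - e x)‖ ≤ c * ‖e y - e x‖ := by
    have ha : writtenInExtChartAt I 𝓘(ℝ, E) x (e' ∘ f) (e y) = e' (f y) := by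
      simp only [writtenInExtChartAt, extChartAt_model_space_eq_id, Function.comp_apply,
        PartialEquiv.refl_coe, id]
      rw [(extChartAt I x).left_inv hys]
    have hb : writtenInExtChartAt I 𝓘(ℝ, E) x (e' ∘ f) (e x) = e' (f x) := by
      simp only [writtenInExtChartAt, extChartAt_model_space_eq_id, Function.comp_apply,
        PartialEquiv.refl_coe, id]
      rw [(extChartAt I x).left_inv (mem_extChartAt_source x)]
    rw [ha, hb] at hy
    exact hy
  have hBD : ∀ w : E, ‖B (D w)‖ = ‖A w‖ := fun w => by
    have h4 : B (D w) = mfderiv I I' f x (A w) := by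
      refine Eq.trans ?_ (tangentOfChart_mfderiv (f x) _)
      rw [show A w = (show TangentSpace I x from w) from tangentOfChart_eq x w]
      rfl
    rw [h4, hiso]
  refine enorm_le_mul_enorm_of_norm_le ?_
  have h5 : ‖e y - e x‖ ≤ ‖T‖ * ‖A (e y - e x)‖ := by
    conv_lhs => rw [← hTA (e y - e x)]
    exact T.le_opNorm _
  have h6 : ‖A (e y - e x)‖ ≤ ‖B (e' (f y) - e' (f x))‖ +
      ‖B‖ * (c * (‖T‖ * ‖A (e y - e x)‖)) := by
    have h7 : B (D (e y - e x)) = B (e' (f y) - e' (f x)) -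
        B ((e' (f y) - e' (f x)) - D (e y - e x)) := by
      rw [← map_sub]; congr 1; abel
    rw [← hBD, h7]
    refine (norm_sub_le _ _).trans (add_le_add le_rfl ?_)
    refine (B.le_opNorm _).trans (mul_le_mul_of_nonneg_left (hy'.trans ?_) (norm_nonneg _))
    rw [← h7, hBD]
    exact mul_le_mul_of_nonneg_left h5 hc.le
  have h8 : (1 - ‖B‖ * (c * ‖T‖)) * ‖A (e y - e x)‖ ≤ ‖B (e' (f y) - e' (f x))‖ := by linarith
  calc ‖A (e y - e x)‖ ≤ r * (1 - ‖B‖ * (c * ‖T‖)) * ‖A (e y - e x)‖ :=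
        le_mul_of_one_le_left (norm_nonneg _) hcr
    _ = r * ((1 - ‖B‖ * (c * ‖T‖)) * ‖A (e y - e x)‖) := by ring
    _ ≤ r * ‖B (e' (f y) - e' (f x))‖ := mul_le_mul_of_nonneg_left h8 r.2

variable [IsContinuousRiemannianBundle E (fun x : M => TangentSpace I x)]

/-- When `E` carries the norm of `T_x M`, the chart at `x` is isometric at `x` itself, hence stretches
nearby tangent vectors by a factor close to `1` at most. -/
theorem eventually_enorm_tangentOfChart_mfderiv_le (x : M) {r : ℝ≥0} (hr : 1 < r) :
    ∀ᶠ y in 𝓝 x, ∀ v : TangentSpace I y,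
      ‖tangentOfChart I x (mfderiv I 𝓘(ℝ, E) (extChartAt I x) y v)‖ₑ ≤ r * ‖v‖ₑ := by
  filter_upwards [eventually_norm_symmL_trivializationAt_self_comp_lt E
    (fun x : M => TangentSpace I x) x (r := r) (by exact_mod_cast hr),
    chart_source_mem_nhds H x] with y hy hyx v
  rw [TangentBundle.continuousLinearMapAt_trivializationAt hyx] at hy
  have h := ((trivializationAt E (fun x : M => TangentSpace I x) x).symmL ℝ x ∘L
    mfderiv I 𝓘(ℝ, E) (extChartAt I x) y).le_of_opNorm_le hy.le v
  exact enorm_le_mul_enorm_of_norm_le h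

/-- When `E` carries the norm of `T_x M`, the inverse of the chart at `x` stretches vectors near the
image of `x` by a factor close to `1` at most. -/
theorem eventually_enorm_mfderivWithin_symm_le (x : M) {r : ℝ≥0} (hr : 1 < r) :
    ∀ᶠ p in 𝓝[range I] (extChartAt I x x), ∀ w : E,
      ‖mfderivWithin 𝓘(ℝ, E) I (extChartAt I x).symm (range I) p w‖ₑ ≤
        r * ‖tangentOfChart I x w‖ₑ := by
  have h : ∀ᶠ y in 𝓝 x, ∀ w : E,
      ‖(trivializationAt E (fun x : M => TangentSpace I x) x).symmL ℝ y w‖ₑ ≤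
        r * ‖tangentOfChart I x w‖ₑ := by
    filter_upwards [eventually_norm_symmL_trivializationAt_comp_self_lt E
      (fun x : M => TangentSpace I x) x (r := r) (by exact_mod_cast hr)] with y hy w
    have h := ContinuousLinearMap.le_of_opNorm_le _ hy.le (tangentOfChart I x w)
    rw [ContinuousLinearMap.comp_apply, tangentOfChart,
      (trivializationAt E (TangentSpace I) x).continuousLinearMapAt_symmL (R := ℝ)
        (FiberBundle.mem_baseSet_trivializationAt' x) w] at h
    exact enorm_le_mul_enorm_of_norm_le h
  have hx : (extChartAt I x).symm (extChartAt I x x) = x := extChartAt_to_inv x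
  have hc : ContinuousAt (extChartAt I x).symm (extChartAt I x x) := continuousAt_extChartAt_symm _
  rw [ContinuousAt, hx] at hc
  filter_upwards [nhdsWithin_le_nhds (hc.eventually h), extChartAt_target_mem_nhdsWithin x]
    with p hp hpt w
  have hs : (extChartAt I x).symm p ∈ (chartAt H x).source := by
    rw [← extChartAt_source I]
    exact (extChartAt I x).map_target hpt
  have := hp w
  rw [TangentBundle.symmL_trivializationAt hs, (extChartAt I x).right_inv hpt] at this
  exact this

/-- Along a short curve near `x`, the displacement in the chart at `x` is at most the length of the
curve, up to a factor close to `1`. -/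
theorem exists_nhds_enorm_tangentOfChart_sub_le_pathELength (x : M) {r : ℝ≥0} (hr : 1 < r) :
    ∃ V ∈ 𝓝 x, ∀ (γ : ℝ → M) (a b : ℝ), a ≤ b → ContMDiffOn 𝓘(ℝ) I 1 γ (Icc a b) →
      (∀ t ∈ Icc a b, γ t ∈ V) →
      ‖tangentOfChart I x (extChartAt I x (γ b) - extChartAt I x (γ a))‖ₑ ≤
        r * pathELength I γ a b := by
  refine ⟨_, inter_mem (eventually_enorm_tangentOfChart_mfderiv_le (I := I) x hr)
    (chart_source_mem_nhds H x), fun γ a b hab hγ hV => ?_⟩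
  rcases hab.eq_or_lt with rfl | hab'
  · simp
  have hc : ContMDiffOn 𝓘(ℝ) 𝓘(ℝ, E) 1 (extChartAt I x ∘ γ) (Icc a b) :=
    contMDiffOn_extChartAt.comp (t := (chartAt H x).source) hγ fun t ht => (hV t ht).2
  have hc' : ContDiffOn ℝ 1 (fun t => tangentOfChart I x (extChartAt I x (γ t))) (Icc a b) :=
    (tangentOfChart I x).contDiff.comp_contDiffOn (contMDiffOn_iff_contDiffOn.1 hc)
  rw [map_sub]
  refine (enorm_sub_le_lintegral_derivWithin_Icc_of_contDiffOn_Icc hc' hab).trans ?_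
  rw [pathELength_eq_lintegral_mfderivWithin_Icc, ← lintegral_const_mul' _ _ ENNReal.coe_ne_top]
  refine setLIntegral_mono' measurableSet_Icc fun t ht => ?_
  have h1 : HasMFDerivWithinAt 𝓘(ℝ) I γ (Icc a b) t (mfderivWithin 𝓘(ℝ) I γ (Icc a b) t) :=
    (hγ.mdifferentiableOn one_ne_zero t ht).hasMFDerivWithinAt
  have h2 : HasMFDerivAt I 𝓘(ℝ, E) (extChartAt I x) (γ t)
      (mfderiv I 𝓘(ℝ, E) (extChartAt I x) (γ t)) :=
    (mdifferentiableAt_extChartAt (hV t ht).2).hasMFDerivAt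
  have h3 := (h2.comp_hasMFDerivWithinAt t h1).hasFDerivWithinAt
  have h4 := ((tangentOfChart I x).hasFDerivAt.comp_hasFDerivWithinAt t h3).hasDerivWithinAt
  have h5 := h4.derivWithin (uniqueDiffOn_Icc hab' t ht)
  refine (congrArg _ h5).trans_le ?_
  exact (hV t ht).1 _

/-- Near `x`, the Riemannian distance from `x` is at most the distance in the chart at `x`, up to a
factor close to `1`. -/
theorem eventually_riemannianEDist_le_chartEDist (x : M) {r : ℝ≥0} (hr : 1 < r) :
    ∀ᶠ y in 𝓝 x, riemannianEDist I x y ≤ r * chartEDist I x y := by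
  obtain ⟨δ, hδ, hball⟩ := Metric.mem_nhdsWithin_iff.1 (inter_mem
    (extChartAt_target_mem_nhdsWithin x) (eventually_enorm_mfderivWithin_symm_le (I := I) x hr))
  have hev : (extChartAt I x) ⁻¹' (Metric.ball (extChartAt I x x) δ) ∈ 𝓝 x :=
    (continuousAt_extChartAt x).preimage_mem_nhds (Metric.ball_mem_nhds _ hδ)
  filter_upwards [hev, extChartAt_source_mem_nhds (I := I) x] with y hy hys
  -- the straight segment in the chart, which stays in the range of the chart by convexity
  let w := extChartAt I x y - extChartAt I x x
  let η : ℝ → E := fun t => extChartAt I x x + t • w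
  have hη0 : η 0 = extChartAt I x x := by simp [η]
  have hη1 : η 1 = extChartAt I x y := by simp [η, w]
  have hηd : ∀ t, HasDerivAt η w t := fun t => by
    have h := ((hasDerivAt_id t).smul_const w).const_add (extChartAt I x x)
    rwa [one_smul] at h
  have hηc : ContDiff ℝ 1 η := by fun_prop
  have hmem : ∀ t ∈ Icc (0 : ℝ) 1, η t ∈ Metric.ball (extChartAt I x x) δ ∩ range I := fun t ht =>
    ((convex_ball _ _).inter I.convex_range).add_smul_sub_mem
      ⟨Metric.mem_ball_self hδ, extChartAt_target_subset_range x (mem_extChartAt_target x)⟩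
      ⟨hy, extChartAt_target_subset_range x ((extChartAt I x).map_source hys)⟩ ht
  have hmem' := fun t ht => hball (hmem t ht)
  have hγ : ContMDiffOn 𝓘(ℝ) I 1 ((extChartAt I x).symm ∘ η) (Icc 0 1) :=
    (contMDiffOn_extChartAt_symm x).comp hηc.contMDiff.contMDiffOn fun t ht => (hmem' t ht).1
  refine (riemannianEDist_le_pathELength hγ (by simp [hη0]) ?_ zero_le_one).trans ?_
  · rw [Function.comp_apply, hη1, (extChartAt I x).left_inv hys]
  have hconst : r * chartEDist I x y = ∫⁻ _ in Icc (0 : ℝ) 1, r * ‖tangentOfChart I x w‖ₑ := by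
    simp [chartEDist, w]
  rw [hconst, pathELength_eq_lintegral_mfderivWithin_Icc]
  refine setLIntegral_mono' measurableSet_Icc fun t ht => ?_
  have h1 : HasMFDerivWithinAt 𝓘(ℝ) 𝓘(ℝ, E) η (Icc 0 1) t
      (ContinuousLinearMap.toSpanSingleton ℝ w) :=
    ((hηd t).hasFDerivAt.hasFDerivWithinAt).hasMFDerivWithinAt
  have h2 := (mdifferentiableWithinAt_extChartAt_symm (hmem' t ht).1).hasMFDerivWithinAt
  have h3 := h2.comp t h1 fun s hs => (hmem s hs).2
  have h4 := h3.mfderivWithin (uniqueDiffOn_Icc zero_lt_one t ht).uniqueMDiffWithinAt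
  rw [h4]
  have := (hmem' t ht).2 w
  refine le_trans (le_of_eq ?_) this
  refine congrArg (fun v => ‖mfderivWithin 𝓘(ℝ, E) I (extChartAt I x).symm (range I) (η t) v‖ₑ) ?_
  exact one_smul ℝ w

/-- A function is `1`-Lipschitz for the Riemannian distance as soon as it is so to first order at
each point: along a curve, the set of times up to which the estimate holds is closed and open to the
right. -/
theorem edist_le_riemannianEDist_of_eventually {X : Type*} [PseudoEMetricSpace X] {f : M → X}
    (h : ∀ x, ∀ r : ℝ≥0, 1 < r → ∀ᶠ y in 𝓝 x, edist (f x) (f y) ≤ r * chartEDist I x y) (x y : M) :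
    edist (f x) (f y) ≤ riemannianEDist I x y := by
  refine le_of_forall_gt fun c hc => ?_
  obtain ⟨γ, rfl, rfl, hγ, hlen⟩ := exists_lt_of_riemannianEDist_lt hc
  refine lt_of_le_of_lt ?_ hlen
  suffices hr : ∀ r : ℝ≥0, 1 < r →
      edist (f (γ 0)) (f (γ 1)) ≤ (r * r : ℝ≥0) * pathELength I γ 0 1 by
    have hlim : Tendsto (fun r : ℝ≥0 => ((r * r : ℝ≥0) : ℝ≥0∞) * pathELength I γ 0 1) (𝓝[>] 1)
        (𝓝 (((1 * 1 : ℝ≥0) : ℝ≥0∞) * pathELength I γ 0 1)) := by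
      refine ENNReal.Tendsto.mul_const ?_ (Or.inl (by simp))
      exact ENNReal.tendsto_coe.2
        ((Continuous.tendsto (by fun_prop) (1 : ℝ≥0)).mono_left nhdsWithin_le_nhds)
    have := ge_of_tendsto hlim (eventually_nhdsWithin_of_forall fun r hr' => hr r hr')
    simpa using this
  intro r hr
  -- one factor `r` comes from `h`, the other from comparing the chart with the length of `γ`
  have hloc : ∀ t ∈ Icc (0 : ℝ) 1, ∃ δ > 0, ∀ s ∈ Icc (0 : ℝ) 1, |s - t| < δ →
      (t ≤ s → edist (f (γ t)) (f (γ s)) ≤ (r * r : ℝ≥0) * pathELength I γ t s) ∧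
      (s ≤ t → edist (f (γ s)) (f (γ t)) ≤ (r * r : ℝ≥0) * pathELength I γ s t) := by
    intro t ht
    obtain ⟨V, hV, hVlen⟩ := exists_nhds_enorm_tangentOfChart_sub_le_pathELength (I := I) (γ t) hr
    obtain ⟨δ, hδ, hball⟩ := Metric.mem_nhdsWithin_iff.1
      (hγ.continuousOn t ht (inter_mem hV (h (γ t) r hr)))
    have hmem : ∀ s ∈ Icc (0 : ℝ) 1, |s - t| < δ → γ s ∈ V ∩ _ := fun s hs hst =>
      hball ⟨by rwa [Metric.mem_ball, Real.dist_eq], hs⟩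
    refine ⟨δ, hδ, fun s hs hst => ⟨fun hts => ?_, fun hts => ?_⟩⟩
    · refine (hmem s hs hst).2.trans ?_
      rw [ENNReal.coe_mul, mul_assoc]
      refine mul_le_mul_right (hVlen γ t s hts (hγ.mono (Icc_subset_Icc ht.1 hs.2))
        fun u hu => (hmem u ⟨ht.1.trans hu.1, hu.2.trans hs.2⟩ ?_).1) _
      rw [abs_lt] at hst ⊢
      constructor <;> linarith [hu.1, hu.2]
    · rw [edist_comm]
      refine (hmem s hs hst).2.trans ?_
      rw [ENNReal.coe_mul, mul_assoc, chartEDist, ← enorm_neg, ← map_neg, neg_sub]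
      refine mul_le_mul_right (hVlen γ s t hts (hγ.mono (Icc_subset_Icc hs.1 ht.2))
        fun u hu => (hmem u ⟨hs.1.trans hu.1, hu.2.trans ht.2⟩ ?_).1) _
      rw [abs_lt] at hst ⊢
      constructor <;> linarith [hu.1, hu.2]
  have hstep : ∀ s t : ℝ, 0 ≤ s → s ≤ t →
      edist (f (γ 0)) (f (γ s)) ≤ (r * r : ℝ≥0) * pathELength I γ 0 s →
      edist (f (γ s)) (f (γ t)) ≤ (r * r : ℝ≥0) * pathELength I γ s t →
      edist (f (γ 0)) (f (γ t)) ≤ (r * r : ℝ≥0) * pathELength I γ 0 t := by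
    intro s t hs hst h1 h2
    rw [← pathELength_add hs hst, mul_add]
    exact (edist_triangle _ _ _).trans (add_le_add h1 h2)
  -- asking for the estimate at all earlier times makes `A` an interval, so that a limit point of
  -- `A` need only be approached from the left
  set A : Set ℝ := {t | ∀ u ∈ Icc (0 : ℝ) t,
    edist (f (γ 0)) (f (γ u)) ≤ (r * r : ℝ≥0) * pathELength I γ 0 u}
  have hA0 : (0 : ℝ) ∈ A := by
    rintro u ⟨hu0, hu1⟩
    obtain rfl := le_antisymm hu1 hu0
    simp
  have hAclosed : IsClosed (A ∩ Icc 0 1) := by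
    refine isClosed_of_closure_subset fun t ht => ?_
    have htI : t ∈ Icc (0 : ℝ) 1 := closure_minimal inter_subset_right isClosed_Icc ht
    refine ⟨fun u hu => ?_, htI⟩
    obtain ⟨δ, hδ, hδ'⟩ := hloc t htI
    rcases hu.2.lt_or_eq with hut | rfl
    · obtain ⟨s, hs, hsu⟩ := mem_closure_iff_nhds.1 ht _ (Ioi_mem_nhds hut)
      exact hsu.1 u ⟨hu.1, le_of_lt hs⟩
    · obtain ⟨s, hs, hsA⟩ := mem_closure_iff_nhds.1 ht _ (Metric.ball_mem_nhds u hδ)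
      rw [Metric.mem_ball, Real.dist_eq] at hs
      rcases le_total u s with hus | hus
      · exact hsA.1 u ⟨hu.1, hus⟩
      · exact hstep s u hsA.2.1 hus (hsA.1 s ⟨hsA.2.1, le_rfl⟩) ((hδ' s hsA.2 hs).2 hus)
  have hsub : Icc (0 : ℝ) 1 ⊆ A := by
    refine hAclosed.Icc_subset_of_forall_exists_gt hA0 fun t ht y hty => ?_
    obtain ⟨δ, hδ, hδ'⟩ := hloc t ⟨ht.2.1, ht.2.2.le⟩
    obtain ⟨s, hts, hs⟩ := exists_between (lt_min (lt_min hty ht.2.2) (lt_add_of_pos_right t hδ))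
    rw [lt_min_iff, lt_min_iff] at hs
    refine ⟨s, fun u hu => ?_, hts, hs.1.1.le⟩
    rcases le_total u t with hut | hut
    · exact ht.1 u ⟨hu.1, hut⟩
    · refine hstep t u ht.2.1 hut (ht.1 t ⟨ht.2.1, le_rfl⟩)
        ((hδ' u ⟨hu.1, hu.2.trans hs.1.2.le⟩ ?_).1 hut)
      rw [abs_lt]
      constructor <;> linarith [hu.2, hs.2]
  exact hsub ⟨zero_le_one, le_rfl⟩ 1 ⟨zero_le_one, le_rfl⟩

end Riemannian

/-! ### Riemannian inclusions -/

section Inclusion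

open scoped NNReal

variable {n : ℕ} [NeZero n] {M M' : Type*}
  [TopologicalSpace M] [ChartedSpace (EuclideanHalfSpace n) M]
  [RiemannianBundle (fun x : M => TangentSpace (𝓡∂ n) x)]
  [TopologicalSpace M'] [ChartedSpace (EuclideanHalfSpace n) M']
  [RiemannianBundle (fun x : M' => TangentSpace (𝓡∂ n) x)] {f : M → M'}

theorem IsRiemannianInclusion.norm_mfderiv (hf : IsRiemannianInclusion n f) (x : M)
    (v : TangentSpace (𝓡∂ n) x) : ‖mfderiv (𝓡∂ n) (𝓡∂ n) f x v‖ = ‖v‖ := by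
  rw [norm_eq_sqrt_real_inner, norm_eq_sqrt_real_inner, hf.2]

theorem IsRiemannianInclusion.mdifferentiableAt (hf : IsRiemannianInclusion n f) (x : M) :
    MDifferentiableAt (𝓡∂ n) (𝓡∂ n) f x :=
  hf.1.mdifferentiable (by simp) x

theorem IsRiemannianInclusion.riemannianEDist_le (hf : IsRiemannianInclusion n f) (x y : M) :
    riemannianEDist (𝓡∂ n) (f x) (f y) ≤ riemannianEDist (𝓡∂ n) x y := by
  refine le_of_forall_gt fun c hc => ?_
  obtain ⟨γ, rfl, rfl, hγ, hlen⟩ := exists_lt_of_riemannianEDist_lt hc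
  have hfγ : ContMDiffOn 𝓘(ℝ) (𝓡∂ n) 1 (f ∘ γ) (Icc 0 1) :=
    (hf.1.of_le (by simp)).comp_contMDiffOn hγ
  refine ((riemannianEDist_le_pathELength hfγ rfl rfl zero_le_one).trans_eq ?_).trans_lt hlen
  simp only [pathELength_eq_lintegral_mfderivWithin_Icc]
  refine MeasureTheory.setLIntegral_congr_fun measurableSet_Icc fun t ht => ?_
  have h := mfderiv_comp_mfderivWithin t (hf.mdifferentiableAt (γ t))
    (hγ.mdifferentiableOn one_ne_zero t ht)
    (uniqueDiffOn_Icc zero_lt_one t ht).uniqueMDiffWithinAt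
  have h' : ‖mfderivWithin 𝓘(ℝ) (𝓡∂ n) (f ∘ γ) (Icc 0 1) t 1‖ =
      ‖mfderivWithin 𝓘(ℝ) (𝓡∂ n) γ (Icc 0 1) t 1‖ := by
    rw [h]
    exact hf.norm_mfderiv (γ t) _
  rw [← ofReal_norm, ← ofReal_norm, h']

/-- Near a point of `M`, the distance of `M` is at most the distance in a chart of `M'`, up to a
factor close to `1`. -/
theorem IsRiemannianInclusion.eventually_riemannianEDist_le [IsManifold (𝓡∂ n) 1 M]
    [IsManifold (𝓡∂ n) 1 M'] [IsContinuousRiemannianBundle (EuclideanSpace ℝ (Fin n))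
      (fun x : M => TangentSpace (𝓡∂ n) x)] (hf : IsRiemannianInclusion n f) (x : M) {r : ℝ≥0}
    (hr : 1 < r) :
    ∀ᶠ y in 𝓝 x, riemannianEDist (𝓡∂ n) x y ≤ r * chartEDist (𝓡∂ n) (f x) (f y) := by
  have hs : 1 < NNReal.sqrt r := by
    rw [← NNReal.sqrt_one]
    exact NNReal.sqrt_lt_sqrt.2 hr
  filter_upwards [eventually_riemannianEDist_le_chartEDist (I := 𝓡∂ n) x hs,
    eventually_chartEDist_le_chartEDist_map (hf.mdifferentiableAt x) (hf.norm_mfderiv x) hs]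
    with y h1 h2
  refine h1.trans ((mul_le_mul_right h2 _).trans_eq ?_)
  rw [← mul_assoc, ← ENNReal.coe_mul, NNReal.mul_self_sqrt]

end Inclusion

/-! ### Lipschitz maps out of spaces with a chain metric -/

section Chain

variable {α X : Type*} [PseudoEMetricSpace X]

theorem edist_le_chainEDist {d : α → α → ℝ≥0∞} {f : α → X}
    (h : ∀ x y, edist (f x) (f y) ≤ d x y) (x y : α) : edist (f x) (f y) ≤ chainEDist d x y := by
  refine le_iInf fun k => le_iInf fun c => le_iInf fun h0 => le_iInf fun hk => ?_
  rw [← h0, ← hk]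
  exact (edist_le_range_sum_edist (fun i => f (c i)) k).trans
    (Finset.sum_le_sum fun i _ => h _ _)

theorem edist_le_quotientEDist [PseudoEMetricSpace α] {R : α → α → Prop}
    {f : QuotientClasses R → X}
    (h : ∀ x y : α, edist (f (Quot.mk R x)) (f (Quot.mk R y)) ≤ edist x y)
    (a b : QuotientClasses R) : edist (f a) (f b) ≤ edist a b := by
  change _ ≤ quotientEDist R a b
  refine le_iInf fun k => le_iInf fun p => le_iInf fun q => le_iInf fun h0 => le_iInf fun hk =>
    le_iInf fun hpq => ?_
  subst h0 hk
  induction k with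
  | zero => simpa using h (p 0) (q 0)
  | succ k ih =>
    rw [Finset.sum_range_succ]
    refine (edist_triangle _ (f (Quot.mk R (q k))) _).trans
      (add_le_add (ih fun i hi => hpq i (by omega)) ?_)
    rw [hpq k (by omega)]
    exact h _ _

/-- Two metrics on quotients of the same set `Z` which agree on `Z` give isometric quotients. -/
theorem exists_isometryEquiv_of_edist_eq {Z A B : Type*} [EMetricSpace A] [EMetricSpace B]
    {u : Z → A} {v : Z → B} (hu : Function.Surjective u) (hv : Function.Surjective v)
    (h : ∀ z w, edist (v z) (v w) = edist (u z) (u w)) : ∃ Ψ : A ≃ᵢ B, ∀ z, Ψ (u z) = v z := by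
  have key : ∀ z, v (Function.surjInv hu (u z)) = v z := fun z => by
    rw [← edist_eq_zero, h, Function.surjInv_eq hu, edist_self]
  have hiso : Isometry fun a => v (Function.surjInv hu a) := fun a b => by
    rw [h, Function.surjInv_eq hu, Function.surjInv_eq hu]
  refine ⟨⟨Equiv.ofBijective _ ⟨hiso.injective, fun b => ?_⟩, hiso⟩, key⟩
  obtain ⟨z, rfl⟩ := hv b
  exact ⟨u z, key z⟩

end Chain

/-! ### The metric of the Hausdorff leaf space -/

namespace Foliation

variable {n : ℕ} [NeZero n] {q : ℕ} {r : ℕ∞ω} {M : Type*} [TopologicalSpace M]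
  [ChartedSpace (EuclideanHalfSpace n) M] [RiemannianBundle (fun x : M => TangentSpace (𝓡∂ n) x)]

theorem edist_toHLS_le_riemannianEDist (F : Foliation n q r M) (x y : M) :
    edist (F.toHLS x) (F.toHLS y) ≤ riemannianEDist (𝓡∂ n) x y := by
  have h1 : F.leafDist (F.toLeafSpace x) (F.toLeafSpace y) ≤ riemannianEDist (𝓡∂ n) x y :=
    iInf₂_le_of_le x (F.mem_leaf x) (iInf₂_le_of_le y (F.mem_leaf y) le_rfl)
  rw [toHLS, toHLS, SeparationQuotient.edist_mk]
  refine (chainEDist_le (d := F.leafDist) 1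
    (fun i => if i = 0 then F.toLeafSpace x else F.toLeafSpace y) (by simp) (by simp)).trans ?_
  simpa using h1

theorem toHLS_eq_of_leaf_eq (F : Foliation n q r M) {x y : M} (h : F.leaf x = F.leaf y) :
    F.toHLS x = F.toHLS y :=
  congrArg SeparationQuotient.mk (Subtype.ext h : F.toLeafSpace x = F.toLeafSpace y)

/-- The Hausdorff leaf space carries the largest metric for which the projection is `1`-Lipschitz:
every `1`-Lipschitz function that is constant on leaves descends to it. -/
theorem edist_le_edist_toHLS (F : Foliation n q r M) {X : Type*} [PseudoEMetricSpace X] {f : M → X}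
    (hleaf : ∀ x y, F.leaf x = F.leaf y → f x = f y)
    (hf : ∀ x y, edist (f x) (f y) ≤ riemannianEDist (𝓡∂ n) x y) (x y : M) :
    edist (f x) (f y) ≤ edist (F.toHLS x) (F.toHLS y) := by
  have hfac : ∀ z, f (F.toLeafSpace z).2.choose = f z := fun z =>
    hleaf _ _ (F.toLeafSpace z).2.choose_spec
  have h := edist_le_chainEDist (d := F.leafDist) (f := fun L : F.LeafSpace => f L.2.choose) ?_
    (F.toLeafSpace x) (F.toLeafSpace y)
  · rw [hfac, hfac] at h
    exact h
  · rintro ⟨_, x, rfl⟩ ⟨_, y, rfl⟩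
    refine le_iInf₂ fun x' hx' => le_iInf₂ fun y' hy' => ?_
    have hx := (hfac x).trans (hleaf x' x (F.leaf_eq_of_mem hx')).symm
    have hy := (hfac y).trans (hleaf y' y (F.leaf_eq_of_mem hy')).symm
    exact (congrArg₂ edist hx hy).trans_le (hf x' y')

end Foliation

/-! ### Gluing Hausdorff leaf spaces -/

theorem edist_toGluedHLS {n : ℕ} [NeZero n] {q : ℕ} {r : ℕ∞ω} {M₁ M₂ : Type*}
    [TopologicalSpace M₁] [ChartedSpace (EuclideanHalfSpace n) M₁]
    [RiemannianBundle (fun x : M₁ => TangentSpace (𝓡∂ n) x)]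
    [TopologicalSpace M₂] [ChartedSpace (EuclideanHalfSpace n) M₂]
    [RiemannianBundle (fun x : M₂ => TangentSpace (𝓡∂ n) x)]
    {S₁ : Set M₁} {S₂ : Set M₂} (F₁ : Foliation n q r M₁) (F₂ : Foliation n q r M₂) (φ : S₁ → S₂)
    (a b : DisjointUnion F₁.HLS F₂.HLS) :
    edist (toGluedHLS F₁ F₂ φ a) (toGluedHLS F₁ F₂ φ b) =
      quotientEDist (HLSGlueRel F₁ F₂ φ) (Quot.mk _ a) (Quot.mk _ b) :=
  SeparationQuotient.edist_mk (X := QuotientClasses (HLSGlueRel F₁ F₂ φ)) _ _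

end

theorem mainTheorem8 {n : ℕ} [NeZero n] {q : ℕ}
    -- two smooth compact Riemannian manifolds with boundary, of dimension `n`
    {M₁ : Type*} [TopologicalSpace M₁] [T2Space M₁] [CompactSpace M₁]
    [ChartedSpace (EuclideanHalfSpace n) M₁] [IsManifold (𝓡∂ n) ∞ M₁]
    [RiemannianBundle (fun x : M₁ => TangentSpace (𝓡∂ n) x)]
    [IsContMDiffRiemannianBundle (𝓡∂ n) ∞ (EuclideanSpace ℝ (Fin n))
      (fun x : M₁ => TangentSpace (𝓡∂ n) x)]
    {M₂ : Type*} [TopologicalSpace M₂] [T2Space M₂] [CompactSpace M₂]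
    [ChartedSpace (EuclideanHalfSpace n) M₂] [IsManifold (𝓡∂ n) ∞ M₂]
    [RiemannianBundle (fun x : M₂ => TangentSpace (𝓡∂ n) x)]
    [IsContMDiffRiemannianBundle (𝓡∂ n) ∞ (EuclideanSpace ℝ (Fin n))
      (fun x : M₂ => TangentSpace (𝓡∂ n) x)]
    -- smooth foliations of codimension `q`
    (F₁ : Foliation n q ∞ M₁) (F₂ : Foliation n q ∞ M₂)
    -- unions of boundary components, to which the foliations are orthogonal
    (S₁ : Set M₁) (S₂ : Set M₂)
    (hS₁ : IsUnionOfBoundaryComponents n S₁) (hS₂ : IsUnionOfBoundaryComponents n S₂)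
    (horth₁ : F₁.IsOrthogonalTo S₁) (horth₂ : F₂.IsOrthogonalTo S₂)
    -- an isometry of `S₁` onto `S₂` mapping leaves onto leaves
    (φ : S₁ ≃ₜ S₂)
    (hφ : ∀ x y : S₁, innerEDist n S₂ (φ x : M₂) (φ y : M₂) = innerEDist n S₁ (x : M₁) (y : M₁))
    (hleaf : ∀ x : S₁,
      (fun y : S₁ => (φ y : M₂)) '' {y | (y : M₁) ∈ F₁.leafIn S₁ x} = F₂.leafIn S₂ (φ x))
    -- the manifold `M₁ ∪_φ M₂`, with a Riemannian metric extending those of `M₁` and `M₂`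
    [ChartedSpace (EuclideanHalfSpace n) (Glue φ)] [IsManifold (𝓡∂ n) ∞ (Glue φ)]
    [RiemannianBundle (fun x : Glue φ => TangentSpace (𝓡∂ n) x)]
    [IsContinuousRiemannianBundle (EuclideanSpace ℝ (Fin n))
      (fun x : Glue φ => TangentSpace (𝓡∂ n) x)]
    (hg₁ : IsRiemannianInclusion n (Glue.inl φ)) (hg₂ : IsRiemannianInclusion n (Glue.inr φ))
    -- the induced foliation of `M₁ ∪_φ M₂`
    {r : ℕ∞ω} (F : Foliation n q r (Glue φ))
    (hF₁ : F.RestrictsTo F₁ (Glue.inl φ)) (hF₂ : F.RestrictsTo F₂ (Glue.inr φ)) :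
    ∃ Ψ : F.HLS ≃ᵢ GluedHLS F₁ F₂ φ,
      ∀ z : M₁ ⊕ M₂, Ψ (F.toHLS (Glue.mk φ z)) = toGluedHLS F₁ F₂ φ (toHLSUnion F₁ F₂ z) := by
  have hS₁c : IsClosed S₁ := hS₁.isClosed
  have hS₂c : IsClosed S₂ := hS₂.isClosed
  have hc₁ : Continuous (Glue.inl φ) := hg₁.1.continuous
  have hc₂ : Continuous (Glue.inr φ) := hg₂.1.continuous
  have : IsManifold (𝓡∂ n) 1 M₁ := .of_le (n := ∞) (by simp)
  have : IsManifold (𝓡∂ n) 1 M₂ := .of_le (n := ∞) (by simp)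
  have : IsManifold (𝓡∂ n) 1 (Glue φ) := .of_le (n := ∞) (by simp)
  have : IsContinuousRiemannianBundle (EuclideanSpace ℝ (Fin n))
    (fun x : M₁ => TangentSpace (𝓡∂ n) x) := .of_contMDiff (𝓡∂ n) (k := ∞)
  have : IsContinuousRiemannianBundle (EuclideanSpace ℝ (Fin n))
    (fun x : M₂ => TangentSpace (𝓡∂ n) x) := .of_contMDiff (𝓡∂ n) (k := ∞)
  have hlip : ∀ a b : DisjointUnion F₁.HLS F₂.HLS,
      edist (toGluedHLS F₁ F₂ φ a) (toGluedHLS F₁ F₂ φ b) ≤ edist a b := fun a b => by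
    rw [edist_toGluedHLS]
    refine (quotientEDist_le 0 (fun _ => a) (fun _ => b) rfl rfl (by simp)).trans ?_
    simp
  -- the map `M → X` induced by the projections of the two pieces
  let f : Glue φ → GluedHLS F₁ F₂ φ := Quot.lift
    (fun z => toGluedHLS F₁ F₂ φ (toHLSUnion F₁ F₂ z)) (by
      rintro _ _ ⟨x⟩
      exact congrArg SeparationQuotient.mk (Quot.sound ⟨x⟩))
  have hf₁ : ∀ x y, edist (f (Glue.inl φ x)) (f (Glue.inl φ y)) ≤ riemannianEDist (𝓡∂ n) x y :=
    fun x y => (hlip _ _).trans (F₁.edist_toHLS_le_riemannianEDist x y)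
  have hf₂ : ∀ x y, edist (f (Glue.inr φ x)) (f (Glue.inr φ y)) ≤ riemannianEDist (𝓡∂ n) x y :=
    fun x y => (hlip _ _).trans (F₂.edist_toHLS_le_riemannianEDist x y)
  have hleaf₁ : ∀ x y, F₁.leaf x = F₁.leaf y → f (Glue.inl φ x) = f (Glue.inl φ y) := fun x y h =>
    congrArg (fun a => toGluedHLS F₁ F₂ φ (Sum.inl a)) (F₁.toHLS_eq_of_leaf_eq h)
  have hleaf₂ : ∀ x y, F₂.leaf x = F₂.leaf y → f (Glue.inr φ x) = f (Glue.inr φ y) := fun x y h =>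
    congrArg (fun a => toGluedHLS F₁ F₂ φ (Sum.inr a)) (F₂.toHLS_eq_of_leaf_eq h)
  have hfleaf : ∀ a b, F.leaf a = F.leaf b → f a = f b := by
    refine fun a b => F.eq_of_leaf_eq_of_eventually fun e he x hx => ?_
    refine Glue.eventually_nhds hS₁c hS₂c φ ?_ ?_
    · rintro z rfl
      filter_upwards [hF₁.eventually_leaf_eq he hx] with y hy hys
      exact hleaf₁ y z (hy hys)
    · rintro z rfl
      filter_upwards [hF₂.eventually_leaf_eq he hx] with y hy hys
      exact hleaf₂ y z (hy hys)
  have hfdist : ∀ a b, edist (f a) (f b) ≤ riemannianEDist (𝓡∂ n) a b := by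
    refine edist_le_riemannianEDist_of_eventually fun a r hr => ?_
    refine Glue.eventually_nhds hS₁c hS₂c φ ?_ ?_
    · rintro z rfl
      filter_upwards [hg₁.eventually_riemannianEDist_le z hr] with y hy
      exact (hf₁ z y).trans hy
    · rintro z rfl
      filter_upwards [hg₂.eventually_riemannianEDist_le z hr] with y hy
      exact (hf₂ z y).trans hy
  have hsurj : Function.Surjective (toHLSUnion F₁ F₂) := by
    rintro (a | a) <;> obtain ⟨⟨_, x, rfl⟩, rfl⟩ := SeparationQuotient.surjective_mk a
    · exact ⟨Sum.inl x, rfl⟩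
    · exact ⟨Sum.inr x, rfl⟩
  have hpiece : ∀ z w : M₁ ⊕ M₂, edist (F.toHLS (Glue.mk φ z)) (F.toHLS (Glue.mk φ w)) ≤
      edist (toHLSUnion F₁ F₂ z) (toHLSUnion F₁ F₂ w) := by
    rintro (x | x) (y | y)
    · exact F₁.edist_le_edist_toHLS (f := fun x => F.toHLS (Glue.inl φ x))
        (fun x y h => F.toHLS_eq_of_leaf_eq (hF₁.leaf_map_eq hc₁ h))
        (fun x y => (F.edist_toHLS_le_riemannianEDist _ _).trans (hg₁.riemannianEDist_le x y)) x y
    · exact le_top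
    · exact le_top
    · exact F₂.edist_le_edist_toHLS (f := fun x => F.toHLS (Glue.inr φ x))
        (fun x y h => F.toHLS_eq_of_leaf_eq (hF₂.leaf_map_eq hc₂ h))
        (fun x y => (F.edist_toHLS_le_riemannianEDist _ _).trans (hg₂.riemannianEDist_le x y)) x y
  -- the map `HLS(F₁) ⊔ HLS(F₂) → HLS(F)` induced by the inclusions of the two pieces
  let g : DisjointUnion F₁.HLS F₂.HLS → F.HLS := fun a =>
    F.toHLS (Glue.mk φ (Function.surjInv hsurj a))
  have hgz : ∀ z, g (toHLSUnion F₁ F₂ z) = F.toHLS (Glue.mk φ z) := fun z => by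
    refine edist_le_zero.1 ((hpiece _ _).trans_eq ?_)
    rw [Function.surjInv_eq hsurj, edist_self]
  let g' : QuotientClasses (HLSGlueRel F₁ F₂ φ) → F.HLS := Quot.lift g (by
    rintro _ _ ⟨x⟩
    rw [hgz, hgz]
    exact congrArg F.toHLS (Quot.sound ⟨x⟩))
  have hg' : ∀ a b, edist (g' a) (g' b) ≤ edist a b := edist_le_quotientEDist fun a b => by
    refine (hpiece _ _).trans_eq ?_
    rw [Function.surjInv_eq hsurj, Function.surjInv_eq hsurj]
  have hg : ∀ z w : M₁ ⊕ M₂, edist (F.toHLS (Glue.mk φ z)) (F.toHLS (Glue.mk φ w)) ≤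
      edist (toGluedHLS F₁ F₂ φ (toHLSUnion F₁ F₂ z))
        (toGluedHLS F₁ F₂ φ (toHLSUnion F₁ F₂ w)) := fun z w => by
    rw [← hgz, ← hgz, edist_toGluedHLS]
    exact hg' _ _
  refine exists_isometryEquiv_of_edist_eq (u := fun z => F.toHLS (Glue.mk φ z)) ?_ ?_
    fun z w => le_antisymm (F.edist_le_edist_toHLS hfleaf hfdist _ _) (hg z w)
  · intro a
    obtain ⟨⟨_, x, rfl⟩, rfl⟩ := SeparationQuotient.surjective_mk a
    obtain ⟨z, rfl⟩ := Quot.exists_rep x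
    exact ⟨z, rfl⟩
  · intro a
    obtain ⟨⟨b⟩, rfl⟩ := SeparationQuotient.surjective_mk a
    obtain ⟨z, rfl⟩ := hsurj b
    exact ⟨z, rfl⟩
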